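/- Let $I\subseteq\mathbb{R}$ be an open interval and let $D : I\times I\to[0,\infty)$ be a divergence function: $D$ is convex on $I\times I$ and $D(\mu,\mu')=0$ if and only if $\mu=\mu'$. (For sample means $m\notin I$, $D(m,\mu)$, $\mu\in I$, denotes an arbitrary finite extension that is measurable in $m$.) Consider a two-armed bandit. When arm $k\in\{1,2\}$ is played for the $i$-th time it yields the real reward $X_k(i)$; the processes $(X_1(i))_{i\ge1}$ and $(X_2(i))_{i\ge1}$ are independent of each other, but each may have arbitrary dependence in $i$. Put $\Lambda_k^n(\theta)=\frac1n\log\mathbb{E}\big[\exp\big(\theta\sum_{i=1}^nX_k(i)\big)\big]\in(-\infty,\infty]$ and assume for $k=1,2$: (A3) the limit $\Lambda_k(\theta)=\lim_{n\to\infty}\Lambda_k^n(\theta)$ exists (possibly infinite) for each $\theta\in\mathbb{R}$, and $0\in\mathcal{L}_k=\mathrm{int}\{\theta\in\mathbb{R}:\Lambda_k(\theta)<\infty\}$; (A4) $\Lambda_k$ is differentiable on $\mathcal{L}_k$, and $\lim_{m\to\infty}|\Lambda_k'(\theta_m)|=\infty$ for every sequence $\theta_m\in\mathcal{L}_k$ converging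 to a boundary point of $\mathcal{L}_k$. Assume $\Lambda_1'(0),\Lambda_2'(0)\in I$ and $\Lambda_1'(0)>\Lambda_2'(0)$ (arm 2 is sub-optimal). Let $N_k(t)$ be the number of plays of arm $k$ up to and including time $t$, and $\widehat\mu_k(t)=\frac{1}{N_k(t)}\sum_{i=1}^{N_k(t)}X_k(i)$. Let the arms be chosen by KL-UCB with divergence $D$: each arm is played once during the first two periods, and for every $t\ge2$ the arm played at time $t+1$ maximizes the index $$U_k(t)=\sup\Big\{\mu\in I: D(\widehat\mu_k(t),\mu)\le\frac{\log t}{N_k(t)}\Big\},$$ ties being broken arbitrarily. Let $\Lambda_1^*(z)=\sup_{\theta\in\mathbb{R}}(\theta z-\Lambda_1(\theta))$. Then for every $\gamma\in(0,1)$, $$\liminf_{T\to\infty}\ \frac{\log\mathbb{P}(N_2(T)\ge x)}{\log x}\ \ge\ -\inf_{z\in I,\ z<\Lambda_2'(0)}\frac{\Lambda_1^*(z)}{D(z,\Lambda_2'(0))}$$ uniformly for $x\in[\log^{1+\gamma}(T),(1-\gamma)T]$ as $T\to\infty$, that is, $$\liminf_{T\to\infty}\ \inf_{x\in[\log^{1+\gamma}(T),\,(1-\gamma)T]}\frac{\log\mathbb{P}(N_2(T)\ge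 x)}{\log x}\ \ge\ -\inf_{z\in I,\ z<\Lambda_2'(0)}\frac{\Lambda_1^*(z)}{D(z,\Lambda_2'(0))},$$ both sides being read in $[-\infty,\infty]$. -/

import Mathlib

open MeasureTheory ProbabilityTheory Filter Topology Set

noncomputable section

namespace KLUCB

/-! ### Reward processes -/

/-- Scaled cumulant generating function `(1/n) log E[exp(θ (X(1) + ⋯ + X(n)))]`, with values in
the extended reals. The rewards `X(1), X(2), …` are stored as `X 0, X 1, …`. -/
def scaledCGF {Ω : Type*} [MeasurableSpace Ω] (P : Measure Ω) (X : ℕ → Ω → ℝ)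
    (n : ℕ) (θ : ℝ) : EReal :=
  (((n : ℝ)⁻¹ : ℝ) : EReal) *
    ENNReal.log (∫⁻ ω, ENNReal.ofReal (Real.exp (θ * ∑ i ∈ Finset.range n, X i ω)) ∂P)

/-- The interior of the set where `Λ` is smaller than `+∞`. -/
def domInterior (Λ : ℝ → EReal) : Set ℝ := interior {θ : ℝ | Λ θ < ⊤}

/-- The derivative `Λ'(θ)` (used only at points of `domInterior Λ`). -/
def slope (Λ : ℝ → EReal) (θ : ℝ) : ℝ := deriv (fun s => (Λ s).toReal) θ

/-- The Gärtner-Ellis conditions for the process `X`, with limiting cumulant generating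
function `Λ`. -/
structure GartnerEllis {Ω : Type*} [MeasurableSpace Ω] (P : Measure Ω) (X : ℕ → Ω → ℝ)
    (Λ : ℝ → EReal) : Prop where
  /-- the limit exists (possibly infinite) at each real `θ` -/
  tendsto : ∀ θ : ℝ, Tendsto (fun n : ℕ => scaledCGF P X n θ) atTop (𝓝 (Λ θ))
  zero_mem : (0 : ℝ) ∈ domInterior Λ
  differentiable : ∀ θ ∈ domInterior Λ, DifferentiableAt ℝ (fun s => (Λ s).toReal) θ
  /-- `|Λ'|` blows up along every sequence converging to a boundary point -/
  steep : ∀ (u : ℕ → ℝ) (b : ℝ), (∀ m, u m ∈ domInterior Λ) → b ∈ frontier (domInterior Λ) →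
    Tendsto u atTop (𝓝 b) → Tendsto (fun m => |slope Λ (u m)|) atTop atTop

/-- The convex conjugate `Λ*(z) = sup_θ (θ z - Λ(θ))`. -/
def conjugate (Λ : ℝ → EReal) (z : ℝ) : EReal := ⨆ θ : ℝ, (((θ * z : ℝ) : EReal) - Λ θ)

/-! ### Divergences and the KL-UCB algorithm -/

/-- `D` is a divergence function on `I × I`: nonnegative, jointly convex, and zero exactly on the
diagonal. The values `D m μ` with `m ∉ I` are those of an arbitrary finite extension, which the
algorithm uses at sample means `m` outside `I`; it is only asked to be measurable in `m`. -/
structure IsDivergence (I : Set ℝ) (D : ℝ → ℝ → ℝ) : Prop where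
  nonneg : ∀ m ∈ I, ∀ μ ∈ I, 0 ≤ D m μ
  convex : ConvexOn ℝ (I ×ˢ I) (fun p : ℝ × ℝ => D p.1 p.2)
  eq_zero_iff : ∀ m ∈ I, ∀ μ ∈ I, (D m μ = 0 ↔ m = μ)
  measurable : ∀ μ ∈ I, Measurable (fun m => D m μ)

/-- `N_k(t)`: number of plays of arm `k` at the times `1, …, t`, if arm `a s` is played at
time `s`. -/
def plays (a : ℕ → Fin 2) (k : Fin 2) (t : ℕ) : ℕ :=
  ((Finset.Icc 1 t).filter (fun s => a s = k)).card

/-- Sample mean of the rewards received from arm `k` up to time `t`; `x k i` is the reward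
received when arm `k` is played for the `(i+1)`-st time. -/
def sampleMean (x : Fin 2 → ℕ → ℝ) (a : ℕ → Fin 2) (k : Fin 2) (t : ℕ) : ℝ :=
  (∑ i ∈ Finset.range (plays a k t), x k i) / (plays a k t : ℝ)

/-- The KL-UCB index `sup {μ ∈ I : D(sample mean of arm k at t, μ) ≤ log t / N_k(t)}`, as an
extended real. -/
def index (I : Set ℝ) (D : ℝ → ℝ → ℝ) (x : Fin 2 → ℕ → ℝ) (a : ℕ → Fin 2)
    (k : Fin 2) (t : ℕ) : EReal :=
  sSup ((fun μ : ℝ => (μ : EReal)) ''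
    {μ : ℝ | μ ∈ I ∧ D (sampleMean x a k t) μ ≤ Real.log (t : ℝ) / (plays a k t : ℝ)})

/-- The arms `a 1, a 2, …` are chosen by KL-UCB when the rewards are `x`: each arm is played once
at the times `1, 2` (in any order), and afterwards an arm with the largest current index is
played (ties broken in any way). -/
def IsKLUCBPath (I : Set ℝ) (D : ℝ → ℝ → ℝ) (x : Fin 2 → ℕ → ℝ) (a : ℕ → Fin 2) : Prop :=
  a 1 ≠ a 2 ∧ ∀ t : ℕ, 2 ≤ t → ∀ j : Fin 2, index I D x a j t ≤ index I D x a (a (t + 1)) t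

end KLUCB

end

/-!
KL-UCB starves the optimal arm `0` whenever its first few rewards are misleadingly small.  Write
`μ₂` for the mean of arm `1`, and fix `z ∈ I` with `z < μ₂`.  Suppose that the mean of the first
`n ≈ log x / D(z, μ₂)` rewards of arm `0` is close to `z`, and that arm `1` behaves typically.
Then, once arm `0` has been played `n` times, its index lies below a level `ν` slightly smaller
than `μ₂` as long as `log t < n D(z, ν)`, that is, up to a time slightly larger than `x`, while the
index of arm `1` lies above `ν`.  Hence arm `0` is played at most `n` times up to time
`⌈x⌉ + n ≤ T`, which leaves at least `x` plays for arm `1`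
(`KLUCB.IsKLUCBPath.le_plays_one_add`).

The typical behaviour of arm `1` has probability at least `1/2` and does not depend on `x`
(`KLUCB.GartnerEllis.exists_goodRewards`): after finitely many plays the sample mean stays close to
`μ₂` by a strong law, and for the finitely many earlier plays `D(·, μ₂)` at the sample mean is
bounded by a constant `K`, which the exploration bonus `log t ≥ log n` exceeds.  The two arms being
independent, the probability in question is at least half of
`P(sample mean of arm 0 after n plays ≈ z)`.

That probability is at least `exp (-n (Λ₀*(z) + η))`
(`KLUCB.GartnerEllis.eventually_lower_bound`), which is `x ^ (-(Λ₀*(z) / D(z, μ₂) + o(1)))`.  It is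
the Gärtner-Ellis lower bound, proved by exponential tilting: for `θ` in the interior of the domain,
the measure with density proportional to `exp (θ Sₙ)` concentrates exponentially fast around
`Sₙ / n = Λ'(θ)` (`KLUCB.GartnerEllis.exists_tail_bound`), and the case `θ = 0` gives the strong law
as well.  No lower semicontinuity of `Λ` is needed: for `z` below the mean, Darboux's theorem,
convexity and steepness show that `Λ'` takes values in every interval `[z, z + δ)`, at some `θ ≤ 0`,
unless `Λ*(z) = ∞` (`KLUCB.GartnerEllis.exists_slope_mem_Ico`).
-/

namespace KLUCB

section

/-! ### Exponential moments and convexity of the limiting generating function -/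

variable {Ω : Type*} [MeasurableSpace Ω] {P : Measure Ω} {X : ℕ → Ω → ℝ} {Λ : ℝ → EReal}

/-- The partial sum `X 0 + ⋯ + X (n - 1)` of the first `n` rewards. -/
def partialSum (X : ℕ → Ω → ℝ) (n : ℕ) (ω : Ω) : ℝ := ∑ i ∈ Finset.range n, X i ω

/-- The exponential moment `E[exp (θ Sₙ)]` of the partial sum, possibly `∞`; `scaledCGF` is `1/n`
times its logarithm. -/
noncomputable def expMoment (P : Measure Ω) (X : ℕ → Ω → ℝ) (n : ℕ) (θ : ℝ) : ENNReal :=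
  ∫⁻ ω, ENNReal.ofReal (Real.exp (θ * partialSum X n ω)) ∂P

lemma measurable_partialSum (hX : ∀ i, Measurable (X i)) (n : ℕ) :
    Measurable (partialSum X n) := by
  unfold partialSum
  exact Finset.measurable_fun_sum _ fun i _ => hX i

lemma scaledCGF_le_iff {n : ℕ} (hn : 0 < n) (θ c : ℝ) :
    scaledCGF P X n θ ≤ c ↔ expMoment P X n θ ≤ ENNReal.ofReal (Real.exp (n * c)) := by
  have hn' : (0 : ℝ) < n := by exact_mod_cast hn
  have h1 : scaledCGF P X n θ = ENNReal.log (expMoment P X n θ) / ((n : ℝ) : EReal) := by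
    rw [EReal.div_eq_inv_mul, ← EReal.coe_inv]
    rfl
  rw [h1, EReal.div_le_iff_le_mul (by exact_mod_cast hn') (EReal.coe_ne_top _), ← EReal.coe_mul,
    ← ENNReal.log_le_log_iff, ENNReal.log_ofReal_of_pos (Real.exp_pos _), Real.log_exp]

lemma GartnerEllis.eventually_expMoment_le (h : GartnerEllis P X Λ) {θ c : ℝ}
    (hc : Λ θ < c) :
    ∀ᶠ n : ℕ in atTop, expMoment P X n θ ≤ ENNReal.ofReal (Real.exp (n * c)) := by
  filter_upwards [(h.tendsto θ).eventually_lt_const hc, eventually_gt_atTop 0] with n hn h0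
  exact (scaledCGF_le_iff h0 θ c).1 hn.le

lemma GartnerEllis.eventually_le_expMoment (h : GartnerEllis P X Λ) {θ c : ℝ}
    (hc : (c : EReal) < Λ θ) :
    ∀ᶠ n : ℕ in atTop, ENNReal.ofReal (Real.exp (n * c)) ≤ expMoment P X n θ := by
  filter_upwards [(h.tendsto θ).eventually_const_lt hc, eventually_gt_atTop 0] with n hn h0
  by_contra hlt
  exact hn.not_ge ((scaledCGF_le_iff h0 θ c).2 (not_le.1 hlt).le)

lemma GartnerEllis.le_of_eventually (h : GartnerEllis P X Λ) {θ c : ℝ}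
    (hc : ∀ᶠ n : ℕ in atTop, expMoment P X n θ ≤ ENNReal.ofReal (Real.exp (n * c))) :
    Λ θ ≤ c := by
  refine le_of_tendsto (h.tendsto θ) ?_
  filter_upwards [hc, eventually_gt_atTop 0] with n hn h0
  exact (scaledCGF_le_iff h0 θ c).2 hn

/-- Log-convexity of `θ ↦ E[exp (θ Sₙ)]`, by Hölder's inequality. -/
lemma expMoment_convex_comb (hX : ∀ i, Measurable (X i)) (n : ℕ) (θ φ : ℝ) {p q : ℝ}
    (hp : 0 ≤ p) (hq : 0 ≤ q) (hpq : p + q = 1) :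
    expMoment P X n (p * θ + q * φ) ≤ expMoment P X n θ ^ p * expMoment P X n φ ^ q := by
  have hm : ∀ θ : ℝ, AEMeasurable
      (fun ω => ENNReal.ofReal (Real.exp (θ * partialSum X n ω))) P := fun θ =>
    ((measurable_partialSum hX n).const_mul θ).exp.ennreal_ofReal.aemeasurable
  refine le_trans (le_of_eq ?_) (ENNReal.lintegral_mul_norm_pow_le (hm θ) (hm φ) hp hq hpq)
  refine lintegral_congr fun ω => ?_
  rw [ENNReal.ofReal_rpow_of_pos (Real.exp_pos _), ENNReal.ofReal_rpow_of_pos (Real.exp_pos _),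
    ← ENNReal.ofReal_mul (Real.rpow_nonneg (Real.exp_pos _).le _), ← Real.exp_mul, ← Real.exp_mul,
    ← Real.exp_add]
  congr 2
  ring

/-- Convexity of `Λ`, stated through real upper bounds so as to avoid sums such as `∞ - ∞`. -/
lemma GartnerEllis.convex_comb_le (h : GartnerEllis P X Λ) (hX : ∀ i, Measurable (X i))
    {θ φ c d p q : ℝ} (hp : 0 ≤ p) (hq : 0 ≤ q) (hpq : p + q = 1)
    (hc : Λ θ < c) (hd : Λ φ < d) :
    Λ (p * θ + q * φ) ≤ ((p * c + q * d : ℝ) : EReal) := by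
  refine h.le_of_eventually ?_
  filter_upwards [h.eventually_expMoment_le hc, h.eventually_expMoment_le hd] with n h1 h2
  refine (expMoment_convex_comb hX n θ φ hp hq hpq).trans ?_
  refine (mul_le_mul' (ENNReal.rpow_le_rpow h1 hp) (ENNReal.rpow_le_rpow h2 hq)).trans
    (le_of_eq ?_)
  rw [ENNReal.ofReal_rpow_of_pos (Real.exp_pos _), ENNReal.ofReal_rpow_of_pos (Real.exp_pos _),
    ← ENNReal.ofReal_mul (Real.rpow_nonneg (Real.exp_pos _).le _), ← Real.exp_mul, ← Real.exp_mul,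
    ← Real.exp_add]
  congr 2
  ring

lemma exists_real_gt_of_lt_top {a : EReal} (ha : a < ⊤) : ∃ c : ℝ, a < c := by
  obtain ⟨c, h1, -⟩ := EReal.lt_iff_exists_real_btwn.1 ha
  exact ⟨c, h1⟩

lemma GartnerEllis.convex_setOf_lt_top (h : GartnerEllis P X Λ) (hX : ∀ i, Measurable (X i)) :
    Convex ℝ {θ : ℝ | Λ θ < ⊤} := by
  intro θ hθ φ hφ p q hp hq hpq
  obtain ⟨c, hc⟩ := exists_real_gt_of_lt_top hθ
  obtain ⟨d, hd⟩ := exists_real_gt_of_lt_top hφ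
  exact (h.convex_comb_le hX hp hq hpq hc hd).trans_lt (EReal.coe_lt_top _)

lemma GartnerEllis.apply_zero [IsProbabilityMeasure P] (h : GartnerEllis P X Λ) : Λ 0 = 0 := by
  refine tendsto_nhds_unique (h.tendsto 0) ?_
  simp [scaledCGF]

lemma domInterior_subset {θ : ℝ} (hθ : θ ∈ domInterior Λ) : Λ θ < ⊤ :=
  interior_subset (s := {θ : ℝ | Λ θ < ⊤}) hθ

/-- `Λ` is finite on the interior of its domain.  The value `-∞` is excluded by convexity and
`Λ 0 = 0`. -/
lemma GartnerEllis.coe_toReal [IsProbabilityMeasure P] (h : GartnerEllis P X Λ)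
    (hX : ∀ i, Measurable (X i)) {θ : ℝ} (hθ : θ ∈ domInterior Λ) :
    (((Λ θ).toReal : ℝ) : EReal) = Λ θ := by
  refine EReal.coe_toReal (domInterior_subset hθ).ne fun hbot => ?_
  -- a point `-t θ` with `t > 0` in the domain, so that `0` is a proper convex combination
  have hev : ∀ᶠ t : ℝ in 𝓝[>] 0, -t * θ ∈ domInterior Λ := by
    have hcont : Tendsto (fun t : ℝ => -t * θ) (𝓝[>] 0) (𝓝 0) := by
      have : Continuous fun t : ℝ => -t * θ := by fun_prop
      simpa using (this.tendsto 0).mono_left nhdsWithin_le_nhds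
    exact hcont (isOpen_interior.mem_nhds h.zero_mem)
  obtain ⟨t, ht, ht0⟩ := (hev.and self_mem_nhdsWithin).exists
  have ht0 : 0 < t := ht0
  obtain ⟨d, hd⟩ := exists_real_gt_of_lt_top (domInterior_subset ht)
  have key := h.convex_comb_le hX (p := t / (1 + t)) (q := 1 / (1 + t)) (by positivity)
    (by positivity) (by field_simp; ring) (c := -(|d| + 1) / t) (hbot ▸ EReal.bot_lt_coe _) hd
  have e1 : t / (1 + t) * θ + 1 / (1 + t) * (-t * θ) = 0 := by field_simp; ring
  rw [e1, h.apply_zero] at key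
  have key' : (0 : ℝ) ≤ t / (1 + t) * (-(|d| + 1) / t) + 1 / (1 + t) * d := by
    exact_mod_cast key
  have e2 : t / (1 + t) * (-(|d| + 1) / t) + 1 / (1 + t) * d = (d - |d| - 1) / (1 + t) := by
    field_simp; ring
  rw [e2] at key'
  have : (d - |d| - 1) / (1 + t) < 0 :=
    div_neg_of_neg_of_pos (by linarith [le_abs_self d]) (by linarith)
  linarith

lemma GartnerEllis.convexOn [IsProbabilityMeasure P] (h : GartnerEllis P X Λ)
    (hX : ∀ i, Measurable (X i)) :
    ConvexOn ℝ (domInterior Λ) (fun θ => (Λ θ).toReal) := by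
  refine ⟨(h.convex_setOf_lt_top hX).interior, fun θ hθ φ hφ p q hp hq hpq => ?_⟩
  have hmem : p • θ + q • φ ∈ domInterior Λ :=
    (h.convex_setOf_lt_top hX).interior hθ hφ hp hq hpq
  refine le_of_forall_pos_le_add fun ε hε => ?_
  have hlt : ∀ {θ : ℝ}, θ ∈ domInterior Λ → Λ θ < (((Λ θ).toReal + ε : ℝ) : EReal) := by
    intro θ hθ
    rw [← h.coe_toReal hX hθ]
    exact_mod_cast lt_add_of_pos_right _ hε
  have key := h.convex_comb_le hX hp hq hpq (hlt hθ) (hlt hφ)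
  rw [← smul_eq_mul, ← smul_eq_mul q φ, ← h.coe_toReal hX hmem, EReal.coe_le_coe_iff] at key
  simp only [smul_eq_mul] at key ⊢
  nlinarith

/-! ### Exponential concentration under tilting -/

/-- Exponential Markov inequality for the measure with density `exp (θ Sₙ)`; the sign of `s` decides
which of the two tails is bounded. -/
lemma setLIntegral_exp_le (hX : ∀ i, Measurable (X i)) (n : ℕ) (θ s z δ : ℝ) :
    ∫⁻ ω in {ω | δ ≤ s * (partialSum X n ω - z)},
        ENNReal.ofReal (Real.exp (θ * partialSum X n ω)) ∂P
      ≤ ENNReal.ofReal (Real.exp (-(s * z + δ))) * expMoment P X n (θ + s) := by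
  have hS := measurable_partialSum hX n
  have hms : MeasurableSet {ω | δ ≤ s * (partialSum X n ω - z)} :=
    measurableSet_le measurable_const ((hS.sub_const z).const_mul s)
  calc _ ≤ ∫⁻ ω in {ω | δ ≤ s * (partialSum X n ω - z)},
        ENNReal.ofReal (Real.exp (-(s * z + δ))) *
          ENNReal.ofReal (Real.exp ((θ + s) * partialSum X n ω)) ∂P := by
        refine setLIntegral_mono' hms fun ω hω => ?_
        rw [← ENNReal.ofReal_mul (Real.exp_pos _).le, ← Real.exp_add]
        refine ENNReal.ofReal_le_ofReal (Real.exp_le_exp.2 ?_)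
        have hω : δ ≤ s * (partialSum X n ω - z) := hω
        nlinarith
    _ ≤ ∫⁻ ω, ENNReal.ofReal (Real.exp (-(s * z + δ))) *
          ENNReal.ofReal (Real.exp ((θ + s) * partialSum X n ω)) ∂P :=
        setLIntegral_le_lintegral _ _
    _ = _ := by
        rw [lintegral_const_mul' _ _ ENNReal.ofReal_ne_top]
        rfl

/-- Exponential bound for one tail under the tilted measure, the upper one for `σ = 1` and the lower
one for `σ = -1`.  The exponent is positive because `Λ (θ + σ t) - Λ θ = σ t Λ'(θ) + o(t)`. -/
lemma GartnerEllis.exists_oneSided_bound [IsProbabilityMeasure P] (h : GartnerEllis P X Λ)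
    (hX : ∀ i, Measurable (X i)) {θ δ : ℝ} (hθ : θ ∈ domInterior Λ) (hδ : 0 < δ) (σ : ℝ) :
    ∃ c > 0, ∀ᶠ n : ℕ in atTop,
      ∫⁻ ω in {ω | n * δ ≤ σ * (partialSum X n ω - n * slope Λ θ)},
        ENNReal.ofReal (Real.exp (θ * partialSum X n ω)) ∂P
      ≤ ENNReal.ofReal (Real.exp (n * ((Λ θ).toReal - c))) := by
  set f : ℝ → ℝ := fun s => (Λ s).toReal with hf
  set z := slope Λ θ with hz
  have hd : HasDerivAt f z θ := (h.differentiable θ hθ).hasDerivAt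
  -- the increment `f (θ + σ t) - f θ` is `t (σ z + o(1))`
  have hev : ∀ᶠ t : ℝ in 𝓝[>] 0, f (θ + σ * t) < f θ + t * (σ * z + δ / 2) := by
    have h0 : HasDerivAt (fun t : ℝ => f (θ + σ * t)) (z * σ) 0 := by
      have h1 : HasDerivAt (fun t : ℝ => θ + σ * t) σ 0 := by
        simpa using ((hasDerivAt_id (0 : ℝ)).const_mul σ).const_add θ
      have h2 : HasDerivAt f z (θ + σ * 0) := by simpa using hd
      exact h2.comp 0 h1
    have h1 := h0.tendsto_slope_zero_right
    have h2 := h1.eventually_lt_const (show z * σ < σ * z + δ / 2 by linarith)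
    filter_upwards [h2, self_mem_nhdsWithin] with t ht ht0
    have ht0 : 0 < t := ht0
    simp only [zero_add, mul_zero, add_zero, smul_eq_mul] at ht
    rw [inv_mul_lt_iff₀ ht0] at ht
    linarith
  have hev2 : ∀ᶠ t : ℝ in 𝓝[>] 0, θ + σ * t ∈ domInterior Λ := by
    have hcont : Tendsto (fun t : ℝ => θ + σ * t) (𝓝[>] 0) (𝓝 θ) := by
      have : Continuous fun t : ℝ => θ + σ * t := by fun_prop
      simpa using (this.tendsto 0).mono_left nhdsWithin_le_nhds
    exact hcont (isOpen_interior.mem_nhds hθ)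
  obtain ⟨t, ⟨ht1, ht2⟩, ht0⟩ := ((hev.and hev2).and self_mem_nhdsWithin).exists
  have ht0 : 0 < t := ht0
  refine ⟨t * (δ / 2), by positivity, ?_⟩
  have hlt : Λ (θ + σ * t) < ((f θ + t * (σ * z + δ / 2) : ℝ) : EReal) := by
    rw [← h.coe_toReal hX ht2]
    exact_mod_cast ht1
  filter_upwards [h.eventually_expMoment_le hlt] with n hn
  have hset : {ω | n * δ ≤ σ * (partialSum X n ω - n * z)} =
      {ω | t * (n * δ) ≤ (σ * t) * (partialSum X n ω - n * z)} := by
    ext ω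
    simp only [mem_ofPred_eq]
    rw [mul_comm σ t, mul_assoc, mul_le_mul_iff_right₀ ht0]
  rw [hset]
  refine (setLIntegral_exp_le hX n θ (σ * t) (n * z) (t * (n * δ))).trans ?_
  refine (mul_le_mul_right hn _).trans (le_of_eq ?_)
  rw [← ENNReal.ofReal_mul (Real.exp_pos _).le, ← Real.exp_add]
  congr 2
  ring

/-- The measure with density `exp (θ Sₙ)`, whose total mass is `exp (n (Λ θ + o(1)))`, gives an
exponentially smaller mass to deviations of `Sₙ / n` from `Λ'(θ)`. -/
lemma GartnerEllis.exists_tail_bound [IsProbabilityMeasure P] (h : GartnerEllis P X Λ)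
    (hX : ∀ i, Measurable (X i)) {θ δ : ℝ} (hθ : θ ∈ domInterior Λ) (hδ : 0 < δ) :
    ∃ c > 0, ∀ᶠ n : ℕ in atTop,
      ∫⁻ ω in {ω | n * δ ≤ |partialSum X n ω - n * slope Λ θ|},
        ENNReal.ofReal (Real.exp (θ * partialSum X n ω)) ∂P
      ≤ ENNReal.ofReal (Real.exp (n * ((Λ θ).toReal - c))) := by
  obtain ⟨c₁, hc₁, h₁⟩ := h.exists_oneSided_bound hX hθ hδ 1
  obtain ⟨c₂, hc₂, h₂⟩ := h.exists_oneSided_bound hX hθ hδ (-1)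
  set c := min c₁ c₂ with hc
  have hcpos : 0 < c := lt_min hc₁ hc₂
  refine ⟨c / 2, by positivity, ?_⟩
  have hlarge : ∀ᶠ n : ℕ in atTop, Real.log 2 ≤ n * (c / 2) :=
    (tendsto_natCast_atTop_atTop.atTop_mul_const (by positivity)).eventually_ge_atTop _
  filter_upwards [h₁, h₂, hlarge] with n h1 h2 h3
  have hsub : {ω | n * δ ≤ |partialSum X n ω - n * slope Λ θ|} ⊆
      {ω | n * δ ≤ 1 * (partialSum X n ω - n * slope Λ θ)} ∪
      {ω | n * δ ≤ (-1) * (partialSum X n ω - n * slope Λ θ)} := by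
    intro ω hω
    have hω : n * δ ≤ |partialSum X n ω - n * slope Λ θ| := hω
    rcases le_abs.1 hω with h | h
    · left; simpa using h
    · right; simpa using h
  refine (lintegral_mono_set hsub).trans ((lintegral_union_le _ _ _).trans ?_)
  have hle : ∀ c' : ℝ, c ≤ c' → ENNReal.ofReal (Real.exp (n * ((Λ θ).toReal - c')))
      ≤ ENNReal.ofReal (Real.exp (n * ((Λ θ).toReal - c))) := fun c' hc' =>
    ENNReal.ofReal_le_ofReal (Real.exp_le_exp.2
      (mul_le_mul_of_nonneg_left (by linarith) (Nat.cast_nonneg n)))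
  refine (add_le_add (h1.trans (hle _ (min_le_left _ _)))
    (h2.trans (hle _ (min_le_right _ _)))).trans ?_
  rw [← ENNReal.ofReal_add (Real.exp_pos _).le (Real.exp_pos _).le]
  refine ENNReal.ofReal_le_ofReal ?_
  calc _ = Real.exp (Real.log 2 + n * ((Λ θ).toReal - c)) := by
        rw [Real.exp_add, Real.exp_log two_pos]; ring
    _ ≤ _ := Real.exp_le_exp.2 (by linarith)

/-! ### The large deviation lower bound and the strong law -/

/-- A point `z` below the mean with `Λ*(z) < ∞` is a limit from above of slopes `Λ'(θ)` with
`θ ≤ 0`. -/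
lemma GartnerEllis.exists_slope_mem_Ico [IsProbabilityMeasure P] (h : GartnerEllis P X Λ)
    (hX : ∀ i, Measurable (X i)) {z ρ δ : ℝ} (hz : z < slope Λ 0) (hρ : conjugate Λ z ≤ ρ)
    (hδ : 0 < δ) :
    ∃ θ ∈ domInterior Λ, θ ≤ 0 ∧ slope Λ θ ∈ Ico z (z + δ) := by
  set f : ℝ → ℝ := fun s => (Λ s).toReal with hf
  have hconv : ConvexOn ℝ (domInterior Λ) f := h.convexOn hX
  have hord : (domInterior Λ).OrdConnected := hconv.1.ordConnected
  have hmono : MonotoneOn (slope Λ) (domInterior Λ) := hconv.monotoneOn_deriv h.differentiable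
  by_contra! hno
  by_cases h0 : slope Λ 0 < z + δ
  · exact hno 0 h.zero_mem le_rfl ⟨hz.le, h0⟩
  push Not at h0
  -- by Darboux's theorem the derivative cannot jump across `[z, z + δ)`
  have hge : ∀ θ ∈ domInterior Λ, θ ≤ 0 → z + δ ≤ slope Λ θ := by
    intro θ hθ hθ0
    by_contra! hlt
    have hlt' : slope Λ θ < z := by
      by_contra! hzle
      exact hno θ hθ hθ0 ⟨hzle, hlt⟩
    have himg : (slope Λ '' (domInterior Λ ∩ Iic 0)).OrdConnected :=
      (hord.inter ordConnected_Iic).image_deriv fun x hx => h.differentiable x hx.1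
    obtain ⟨φ, ⟨hφ, hφ0⟩, hφz⟩ := himg.out (mem_image_of_mem _ ⟨hθ, hθ0⟩)
      (mem_image_of_mem _ ⟨h.zero_mem, le_refl (0 : ℝ)⟩) ⟨hlt'.le, hz.le⟩
    exact hno φ hφ hφ0 (by rw [hφz]; exact ⟨le_rfl, by linarith⟩)
  by_cases hbdd : BddBelow (domInterior Λ)
  · -- a finite left end point contradicts steepness, the derivative being bounded near it
    set b := sInf (domInterior Λ) with hb
    have hne : (domInterior Λ).Nonempty := ⟨0, h.zero_mem⟩
    have hglb : IsGLB (domInterior Λ) b := isGLB_csInf hne hbdd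
    have hopen : IsOpen (domInterior Λ) := isOpen_interior
    have hb_not : b ∉ domInterior Λ := by
      intro hmem
      have hev : ∀ᶠ y in 𝓝[<] b, y ∈ domInterior Λ :=
        nhdsWithin_le_nhds (hopen.mem_nhds hmem)
      obtain ⟨y, hy, hyL⟩ := (hev.and self_mem_nhdsWithin).exists
      exact (hglb.1 hy).not_gt hyL
    have hfr : b ∈ frontier (domInterior Λ) := by
      rw [hopen.frontier_eq]
      exact ⟨hglb.mem_closure hne, hb_not⟩
    obtain ⟨u, -, hu, hlim, humem⟩ := hglb.exists_seq_antitone_tendsto hne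
    have hst := h.steep u b humem hfr hlim
    have hb0 : b < 0 := lt_of_le_of_ne (hglb.1 h.zero_mem) fun e => hb_not (e ▸ h.zero_mem)
    obtain ⟨m, hm1, hm2⟩ := ((hst.eventually_gt_atTop (max |z + δ| |slope Λ 0|)).and
      (hlim.eventually_lt_const hb0)).exists
    have h1 := hge (u m) (humem m) hm2.le
    have h2 := hmono (humem m) h.zero_mem hm2.le
    exact hm1.not_ge (abs_le_max_abs_abs h1 h2)
  · -- an infinite left end point makes the conjugate infinite at `z`
    have hmem : ∀ θ ≤ 0, θ ∈ domInterior Λ := by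
      intro θ hθ
      rw [not_bddBelow_iff] at hbdd
      obtain ⟨y, hy, hyθ⟩ := hbdd θ
      exact hord.out hy h.zero_mem ⟨hyθ.le, hθ⟩
    -- `θ z - Λ θ ≥ -θ δ` for `θ ≤ 0`, and this exceeds `ρ` at the following `θ`
    set θ : ℝ := -(|ρ| + 1) / δ with hθ
    have hθ0 : θ < 0 := div_neg_of_neg_of_pos (by linarith [abs_nonneg ρ]) hδ
    have h1 : f θ ≤ θ * (z + δ) := by
      have h2 := hconv.deriv_le_slope (hmem θ hθ0.le) h.zero_mem hθ0
        (h.differentiable θ (hmem θ hθ0.le))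
      have h3 : z + δ ≤ _root_.slope f θ 0 := (hge θ (hmem θ hθ0.le) hθ0.le).trans h2
      have hf0 : f 0 = 0 := by simp [hf, h.apply_zero]
      rw [slope_def_field, hf0, le_div_iff₀ (by linarith)] at h3
      linarith
    have h4 : (((θ * z - f θ : ℝ)) : EReal) ≤ ρ := by
      refine le_trans ?_ hρ
      rw [EReal.coe_sub, h.coe_toReal hX (hmem θ hθ0.le)]
      exact le_iSup (fun θ : ℝ => (((θ * z : ℝ) : EReal) - Λ θ)) θ
    have h4 : θ * z - f θ ≤ ρ := by exact_mod_cast h4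
    have h5 : θ * δ = -(|ρ| + 1) := by rw [hθ]; field_simp
    linarith [le_abs_self ρ]

/-- Gärtner-Ellis lower bound at a point below the mean. -/
lemma GartnerEllis.eventually_lower_bound [IsProbabilityMeasure P] (h : GartnerEllis P X Λ)
    (hX : ∀ i, Measurable (X i)) {z ρ δ η : ℝ} (hz : z < slope Λ 0) (hρ : conjugate Λ z ≤ ρ)
    (hδ : 0 < δ) (hη : 0 < η) :
    ∀ᶠ n : ℕ in atTop, ENNReal.ofReal (Real.exp (-(n * (ρ + η))))
      ≤ P {ω | |partialSum X n ω - n * z| < n * δ} := by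
  obtain ⟨θ, hθ, hθ0, hzθ, hθz⟩ := h.exists_slope_mem_Ico hX hz hρ (half_pos hδ)
  set w := slope Λ θ with hw
  set f := (Λ θ).toReal with hf
  -- the concentration radius is also small enough that `exp (θ Sₙ)` varies by at most
  -- `exp (± n η / 3)` within it
  set δ' := min (δ / 2) (η / (3 * (|θ| + 1))) with hδ'
  have hδ'0 : 0 < δ' := lt_min (by positivity) (by positivity)
  have hθδ : |θ| * δ' ≤ η / 3 := by
    have h1 : δ' ≤ η / (3 * (|θ| + 1)) := min_le_right _ _
    rw [le_div_iff₀ (by positivity)] at h1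
    nlinarith [abs_nonneg θ]
  obtain ⟨c, hc, htail⟩ := h.exists_tail_bound hX hθ hδ'0
  -- `κ < c` makes the mass `exp (n (f - c))` of the tails negligible against the total mass
  set κ := min (c / 2) (η / 6) with hκ
  have hκ0 : 0 < κ := lt_min (by positivity) (by positivity)
  have hκc : κ ≤ c / 2 := min_le_left _ _
  have hκη : κ ≤ η / 6 := min_le_right _ _
  have hfΛ : ((f : ℝ) : EReal) = Λ θ := h.coe_toReal hX hθ
  have hlow : ∀ᶠ n : ℕ in atTop,
      ENNReal.ofReal (Real.exp (n * (f - κ))) ≤ expMoment P X n θ :=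
    h.eventually_le_expMoment (by rw [← hfΛ]; exact_mod_cast sub_lt_self f hκ0)
  have hfρ : θ * z - f ≤ ρ := by
    have h4 : (((θ * z - f : ℝ)) : EReal) ≤ ρ := by
      refine le_trans ?_ hρ
      rw [EReal.coe_sub, hfΛ]
      exact le_iSup (fun θ : ℝ => (((θ * z : ℝ) : EReal) - Λ θ)) θ
    exact_mod_cast h4
  have hl1 : ∀ᶠ n : ℕ in atTop, Real.log 2 ≤ n * κ :=
    (tendsto_natCast_atTop_atTop.atTop_mul_const hκ0).eventually_ge_atTop _
  filter_upwards [htail, hlow, hl1, eventually_gt_atTop 0] with n h1 h2 h3 hn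
  have hn0 : (0 : ℝ) < n := by exact_mod_cast hn
  set G := {ω | |partialSum X n ω - n * w| < n * δ'} with hG
  have hGm : MeasurableSet G :=
    measurableSet_lt ((measurable_partialSum hX n).sub_const _).abs measurable_const
  have hGc : Gᶜ = {ω | n * δ' ≤ |partialSum X n ω - n * w|} := by
    ext ω; simp [hG]
  have hsub : G ⊆ {ω | |partialSum X n ω - n * z| < n * δ} := by
    intro ω hω
    have hω : |partialSum X n ω - n * w| < n * δ' := hω
    have hδ2 : δ' ≤ δ / 2 := min_le_left _ _
    rw [abs_lt] at hω
    show |partialSum X n ω - n * z| < n * δ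
    rw [abs_lt]
    constructor <;> nlinarith
  refine le_trans ?_ (measure_mono hsub)
  -- on `G` the density `exp (θ Sₙ)` is at most `B`
  set B := Real.exp (n * (θ * w + |θ| * δ')) with hB
  have hGint : ∫⁻ ω in G, ENNReal.ofReal (Real.exp (θ * partialSum X n ω)) ∂P
      ≤ ENNReal.ofReal B * P G := by
    rw [← setLIntegral_const]
    refine setLIntegral_mono' hGm fun ω hω => ENNReal.ofReal_le_ofReal (Real.exp_le_exp.2 ?_)
    have hω : |partialSum X n ω - n * w| < n * δ' := hω
    have h4 : θ * (partialSum X n ω - n * w) ≤ |θ| * (n * δ') :=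
      (le_abs_self _).trans ((abs_mul _ _).le.trans
        (mul_le_mul_of_nonneg_left hω.le (abs_nonneg _)))
    linarith
  have hsplit : expMoment P X n θ ≤ ENNReal.ofReal B * P G +
      ENNReal.ofReal (Real.exp (n * (f - c))) := by
    unfold expMoment
    rw [← lintegral_add_compl _ hGm]
    refine add_le_add hGint ?_
    rw [hGc]
    exact h1
  have hreal : Real.exp (n * (f - κ)) ≤ B * (P G).toReal + Real.exp (n * (f - c)) := by
    have h5 := h2.trans hsplit
    rw [← ENNReal.ofReal_toReal (measure_ne_top P G), ← ENNReal.ofReal_mul (Real.exp_pos _).le,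
      ← ENNReal.ofReal_add (by positivity) (Real.exp_pos _).le] at h5
    exact (ENNReal.ofReal_le_ofReal_iff (by positivity)).1 h5
  have h6 : Real.exp (n * (f - c)) ≤ Real.exp (n * (f - κ)) / 2 := by
    rw [le_div_iff₀ two_pos]
    calc _ = Real.exp (n * (f - c) + Real.log 2) := by rw [Real.exp_add, Real.exp_log two_pos]
      _ ≤ _ := Real.exp_le_exp.2 (by nlinarith)
  have h7 : Real.exp (-(n * (ρ + η))) * B ≤ Real.exp (n * (f - κ)) / 2 := by
    rw [le_div_iff₀ two_pos, hB, ← Real.exp_add]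
    calc _ = Real.exp (-(n * (ρ + η)) + n * (θ * w + |θ| * δ') + Real.log 2) := by
          rw [Real.exp_add _ (Real.log 2), Real.exp_log two_pos]
      _ ≤ _ := Real.exp_le_exp.2 ?_
    have h8 : θ * w ≤ θ * z := mul_le_mul_of_nonpos_left hzθ hθ0
    have h9 : -(ρ + η) + (θ * w + |θ| * δ') + κ ≤ f - κ := by linarith
    nlinarith
  refine (ENNReal.ofReal_le_iff_le_toReal (measure_ne_top P G)).2 ?_
  exact le_of_mul_le_mul_right (by linarith) (Real.exp_pos _ : 0 < B)

/-- Strong law of large numbers, by the Borel-Cantelli lemma. -/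
lemma GartnerEllis.ae_eventually_abs_lt [IsProbabilityMeasure P] (h : GartnerEllis P X Λ)
    (hX : ∀ i, Measurable (X i)) {δ : ℝ} (hδ : 0 < δ) :
    ∀ᵐ ω ∂P, ∀ᶠ n : ℕ in atTop, |partialSum X n ω - n * slope Λ 0| < n * δ := by
  obtain ⟨c, hc, htail⟩ := h.exists_tail_bound hX h.zero_mem hδ
  set s : ℕ → Set Ω := fun n => {ω | n * δ ≤ |partialSum X n ω - n * slope Λ 0|} with hs
  have hbound : ∀ᶠ n : ℕ in atTop, P (s n) ≤ ENNReal.ofReal (Real.exp (-c) ^ n) := by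
    filter_upwards [htail] with n hn
    have e : ((Λ 0).toReal - c) = -c := by simp [h.apply_zero]
    rw [e] at hn
    simp only [zero_mul, Real.exp_zero, ENNReal.ofReal_one, lintegral_one,
      Measure.restrict_apply_univ] at hn
    rwa [← Real.exp_nat_mul]
  obtain ⟨N, hN⟩ := eventually_atTop.1 hbound
  have hsum : ∑' n, P (s (n + N)) ≠ ⊤ := by
    have hgeo : Summable fun n : ℕ => Real.exp (-c) ^ (n + N) :=
      (summable_nat_add_iff N).2 (summable_geometric_of_lt_one (Real.exp_pos _).le
        (by simpa using hc))
    refine ne_top_of_le_ne_top ?_ (ENNReal.tsum_le_tsum fun n => hN (n + N) (by omega))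
    exact hgeo.tsum_ofReal_ne_top
  filter_upwards [ae_eventually_notMem hsum] with ω hω
  filter_upwards [(tendsto_sub_atTop_nat N).eventually hω, eventually_ge_atTop N] with n hn hle
  rw [Nat.sub_add_cancel hle] at hn
  exact not_le.1 hn

/-! ### Typical rewards of the sub-optimal arm -/

/-- The reward sequences whose sample means stay within `δ` of `μ` from the `N`-th reward on, and
whose earlier sample means have a value of `g` at most `K`.  For the bandit `g` is `D(·, μ)`: the
second clause takes care of early sample means, which may even lie outside `I`. -/
def goodRewards (g : ℝ → ℝ) (μ δ : ℝ) (N : ℕ) (K : ℝ) : Set (ℕ → ℝ) :=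
  {y | (∀ n ≥ N, |∑ i ∈ Finset.range n, y i - n * μ| < n * δ) ∧
    ∀ j < N, g ((∑ i ∈ Finset.range j, y i) / j) ≤ K}

lemma measurableSet_goodRewards {g : ℝ → ℝ} (hg : Measurable g) (μ δ : ℝ) (N : ℕ) (K : ℝ) :
    MeasurableSet (goodRewards g μ δ N K) := by
  have hS : ∀ n : ℕ, Measurable fun y : ℕ → ℝ => ∑ i ∈ Finset.range n, y i := fun n =>
    Finset.measurable_fun_sum _ fun i _ => measurable_pi_apply i
  refine MeasurableSet.inter (measurableSet_setOfPred.2 ?_) (measurableSet_setOfPred.2 ?_)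
  · refine Measurable.forall fun n => Measurable.imp measurable_const ?_
    exact measurableSet_setOfPred.1 (measurableSet_lt ((hS n).sub_const _).abs measurable_const)
  · refine Measurable.forall fun j => Measurable.imp measurable_const ?_
    exact measurableSet_setOfPred.1 (measurableSet_le (hg.comp ((hS j).div_const _)) measurable_const)

lemma exists_lt_measure_of_monotone {s : ℕ → Set Ω} (hs : Monotone s) {t : ENNReal}
    (ht : t < P (⋃ n, s n)) : ∃ n, t < P (s n) :=
  ((tendsto_measure_iUnion_atTop hs).eventually_const_lt ht).exists

lemma GartnerEllis.exists_goodRewards [IsProbabilityMeasure P] (h : GartnerEllis P X Λ)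
    (hX : ∀ i, Measurable (X i)) (g : ℝ → ℝ) {δ : ℝ} (hδ : 0 < δ) :
    ∃ N K, 2⁻¹ ≤ P ((fun ω i => X i ω) ⁻¹' goodRewards g (slope Λ 0) δ N K) := by
  set A : ℕ → Set Ω := fun N => {ω | ∀ n ≥ N, |partialSum X n ω - n * slope Λ 0| < n * δ} with hA
  have hAmono : Monotone A := fun N M hNM ω hω n hn => hω n (hNM.trans hn)
  have hAfull : P (⋃ N, A N) = 1 := by
    have hmem : ⋃ N, A N ∈ ae P := by
      filter_upwards [h.ae_eventually_abs_lt hX hδ] with ω hω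
      exact mem_iUnion.2 (eventually_atTop.1 hω)
    rw [measure_congr (eventuallyEq_univ.2 hmem), measure_univ]
  obtain ⟨N, hN⟩ := exists_lt_measure_of_monotone hAmono (t := 2⁻¹) (by
    rw [hAfull]; exact ENNReal.inv_lt_one.2 ENNReal.one_lt_two)
  set B : ℕ → Set Ω := fun K => {ω | ω ∈ A N ∧
    ∀ j < N, g (partialSum X j ω / j) ≤ (K : ℝ)} with hB
  have hBmono : Monotone B := fun K M hKM ω hω =>
    ⟨hω.1, fun j hj => (hω.2 j hj).trans (by exact_mod_cast hKM)⟩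
  have hBU : ⋃ K, B K = A N := by
    refine Subset.antisymm (iUnion_subset fun K ω hω => hω.1) fun ω hω => ?_
    obtain ⟨K, hK⟩ := exists_nat_ge (∑ j ∈ Finset.range N, |g (partialSum X j ω / j)|)
    refine mem_iUnion.2 ⟨K, hω, fun j hj => (le_abs_self _).trans (le_trans ?_ hK)⟩
    exact Finset.single_le_sum (f := fun j : ℕ => |g (partialSum X j ω / j)|)
      (fun i _ => abs_nonneg _) (Finset.mem_range.2 hj)
  obtain ⟨K, hK⟩ := exists_lt_measure_of_monotone hBmono (t := 2⁻¹) (by rwa [hBU])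
  exact ⟨N, K, hK.le⟩

/-! ### Divergence functions -/

variable {I : Set ℝ} {D : ℝ → ℝ → ℝ}

/-- By convexity `D m` is nondecreasing to the right of its zero `m`. -/
lemma IsDivergence.mono_right (hD : IsDivergence I D) {m ν μ : ℝ} (hm : m ∈ I)
    (hμ : μ ∈ I) (h1 : m < ν) (h2 : ν ≤ μ) : D m ν ≤ D m μ := by
  have hmμ : 0 < μ - m := by linarith
  set s := (ν - m) / (μ - m) with hs
  have hs0 : 0 ≤ s := div_nonneg (by linarith) hmμ.le
  have hs1 : s ≤ 1 := (div_le_one hmμ).2 (by linarith)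
  have hmm : ((m, m) : ℝ × ℝ) ∈ I ×ˢ I := ⟨hm, hm⟩
  have hmμI : ((m, μ) : ℝ × ℝ) ∈ I ×ˢ I := ⟨hm, hμ⟩
  have hc := hD.convex.2 hmm hmμI (sub_nonneg.2 hs1) hs0 (by ring)
  have e2 : (1 - s) * m + s * μ = ν := by
    have : s * (μ - m) = ν - m := by rw [hs]; field_simp
    linarith
  have e1 : (1 - s) * m + s * m = m := by ring
  simp only [Prod.smul_mk, Prod.mk_add_mk, smul_eq_mul, e1, e2] at hc
  rw [(hD.eq_zero_iff m hm m hm).2 rfl] at hc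
  nlinarith [hD.nonneg m hm μ hμ]

/-- A strict lower bound on `D` persists nearby, `D` being convex, hence continuous, on the open set
`I ×ˢ I`. -/
lemma IsDivergence.exists_nhds_lt (hD : IsDivergence I D) (hI : IsOpen I) {z μ d : ℝ}
    (hz : z ∈ I) (hμ : μ ∈ I) (hd : d < D z μ) :
    ∃ e > 0, ∀ m ν, |m - z| < e → |ν - μ| < e → m ∈ I ∧ ν ∈ I ∧ d < D m ν := by
  have hopen : IsOpen (I ×ˢ I) := hI.prod hI
  have hmem : ((z, μ) : ℝ × ℝ) ∈ I ×ˢ I := ⟨hz, hμ⟩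
  have hcont := (hD.convex.continuousOn hopen).continuousAt (hopen.mem_nhds hmem)
  have hev : ∀ᶠ p : ℝ × ℝ in 𝓝 (z, μ), p ∈ I ×ˢ I ∧ d < D p.1 p.2 :=
    (hopen.eventually_mem hmem).and (hcont.eventually_const_lt hd)
  obtain ⟨e, he, h⟩ := Metric.eventually_nhds_iff.1 hev
  refine ⟨e, he, fun m ν hm hν => ?_⟩
  have := @h (m, ν) (by rw [Prod.dist_eq]; exact max_lt hm hν)
  exact ⟨this.1.1, this.1.2, this.2⟩

/-! ### Paths of the algorithm -/

variable {x : Fin 2 → ℕ → ℝ} {a : ℕ → Fin 2}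

lemma plays_succ (a : ℕ → Fin 2) (k : Fin 2) (t : ℕ) :
    plays a k (t + 1) = plays a k t + if a (t + 1) = k then 1 else 0 := by
  unfold plays
  rw [← Finset.insert_Icc_right_eq_Icc_add_one (by omega), Finset.filter_insert]
  split_ifs with h
  · rw [Finset.card_insert_of_notMem (by simp)]
  · simp

lemma plays_zero_time (a : ℕ → Fin 2) (k : Fin 2) : plays a k 0 = 0 := by simp [plays]

lemma plays_mono (a : ℕ → Fin 2) (k : Fin 2) : Monotone (plays a k) :=
  monotone_nat_of_le_succ fun t => by rw [plays_succ]; omega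

lemma plays_add_plays (a : ℕ → Fin 2) (t : ℕ) : plays a 0 t + plays a 1 t = t := by
  induction t with
  | zero => simp [plays_zero_time]
  | succ t ih =>
    rw [plays_succ, plays_succ]
    have : a (t + 1) = 0 ∨ a (t + 1) = 1 := by omega
    rcases this with h | h <;> simp [h] <;> omega

lemma IsKLUCBPath.plays_two (h : IsKLUCBPath I D x a) (k : Fin 2) : plays a k 2 = 1 := by
  have h12 := h.1
  have e : plays a k 2 = (if a 1 = k then 1 else 0) + if a 2 = k then 1 else 0 := by
    rw [plays_succ a k 1, plays_succ a k 0, plays_zero_time, zero_add]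
  rw [e]
  split_ifs <;> omega

/-- If arm `0` has the smaller index whenever it has been played exactly `n` times, then it is never
played an `(n + 1)`-st time. -/
lemma IsKLUCBPath.plays_zero_le (h : IsKLUCBPath I D x a) {n τ : ℕ} (hn : 1 ≤ n)
    (hidx : ∀ t, 2 ≤ t → t < τ → plays a 0 t = n → index I D x a 0 t < index I D x a 1 t) :
    ∀ t, 2 ≤ t → t ≤ τ → plays a 0 t ≤ n := by
  intro t ht
  induction t, ht using Nat.le_induction with
  | base => intro _; rw [h.plays_two]; exact hn
  | succ t ht ih =>
    intro htτ
    rw [plays_succ]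
    rcases (ih (by omega)).lt_or_eq with hlt | heq
    · split_ifs <;> omega
    · have hlt := hidx t ht (by omega) heq
      have hne : a (t + 1) ≠ 0 := fun h0 => (h.2 t ht 1).not_gt (h0 ▸ hlt)
      simp [hne, heq]

/-- Starvation of arm `0`.  The level `ν` separates the two indices when arm `0` has been played `n`
times: its own index is at most `ν` by `hτn` and `h0`, and that of arm `1` exceeds `ν` by `h1`,
either because its sample mean does or because its exploration bonus admits `μ'`. -/
lemma IsKLUCBPath.le_plays_one_add (h : IsKLUCBPath I D x a) {n τ : ℕ} (hn : 1 ≤ n) (hτ : 2 ≤ τ)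
    {d ν μ' : ℝ} (hμ' : μ' ∈ I) (hνμ' : ν < μ')
    (hD : IsDivergence I D)
    (hτn : Real.log τ < d * n)
    (h0 : ∀ μ ∈ I, ν ≤ μ → d ≤ D ((∑ i ∈ Finset.range n, x 0 i) / n) μ)
    (h1 : ∀ j : ℕ, 1 ≤ j → ((∑ i ∈ Finset.range j, x 1 i) / j ∈ I ∧
        ν < (∑ i ∈ Finset.range j, x 1 i) / j) ∨
      D ((∑ i ∈ Finset.range j, x 1 i) / j) μ' * j ≤ Real.log n) :
    τ ≤ plays a 1 τ + n := by
  have hle := h.plays_zero_le (τ := τ) hn ?_ τ hτ le_rfl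
  · have := plays_add_plays a τ
    omega
  intro t ht htτ hplays
  have hn0 : (0 : ℝ) < n := by exact_mod_cast hn
  have ht0 : (0 : ℝ) < t := by exact_mod_cast (by omega : 0 < t)
  have hlow : index I D x a 0 t ≤ (ν : EReal) := by
    refine sSup_le ?_
    rintro _ ⟨μ, ⟨hμI, hμ⟩, rfl⟩
    rw [sampleMean, hplays, le_div_iff₀ hn0] at hμ
    have hlog : Real.log t ≤ Real.log τ := Real.log_le_log ht0 (by exact_mod_cast htτ.le)
    by_contra hlt
    have hνμ : ν ≤ μ := by
      by_contra hh
      exact hlt (EReal.coe_le_coe_iff.2 (not_le.1 hh).le)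
    have := h0 μ hμI hνμ
    nlinarith
  refine hlow.trans_lt ?_
  have hj : 1 ≤ plays a 1 t := (h.plays_two 1).symm.le.trans (plays_mono a 1 ht)
  have hj0 : (0 : ℝ) < (plays a 1 t : ℝ) := by exact_mod_cast hj
  have hidx : ∀ μ ∈ I, D (sampleMean x a 1 t) μ * plays a 1 t ≤ Real.log t →
      (μ : EReal) ≤ index I D x a 1 t := fun μ hμ hle =>
    le_sSup ⟨μ, ⟨hμ, (le_div_iff₀ hj0).2 hle⟩, rfl⟩
  have hnt : n ≤ t := by
    have := plays_add_plays a t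
    omega
  rcases h1 _ hj with ⟨hI, hν⟩ | hK
  · refine lt_of_lt_of_le (EReal.coe_lt_coe_iff.2 hν) (hidx _ hI ?_)
    have : D (sampleMean x a 1 t) ((∑ i ∈ Finset.range (plays a 1 t), x 1 i) / (plays a 1 t : ℝ)) = 0 :=
      (hD.eq_zero_iff _ hI _ hI).2 rfl
    rw [this, zero_mul]
    exact Real.log_nonneg (by exact_mod_cast (by omega : 1 ≤ t))
  · refine lt_of_lt_of_le (EReal.coe_lt_coe_iff.2 hνμ') (hidx _ hμ' (hK.trans ?_))
    exact Real.log_le_log hn0 (by exact_mod_cast hnt)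

end

/-! ### The probability of starvation -/

/-- For `ρ ≥ Λ₀*(z)` and `r > ρ / D(z, μ₂)`, eventually `P(N₂(T) ≥ x) ≥ x ^ (-r)`, uniformly in the
times `T` that exceed `x` by a multiple of `log x`. -/
lemma eventually_le_measure_plays {Ω : Type*} [MeasurableSpace Ω] {P : Measure Ω}
    [IsProbabilityMeasure P] {I : Set ℝ} (hI : IsOpen I) {D : ℝ → ℝ → ℝ} (hD : IsDivergence I D)
    {X : Fin 2 → ℕ → Ω → ℝ} (hX : ∀ k i, Measurable (X k i))
    (hX_indep : IndepFun (fun ω i => X 0 i ω) (fun ω i => X 1 i ω) P)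
    {Λ : Fin 2 → ℝ → EReal} (hΛ : ∀ k, GartnerEllis P (X k) (Λ k))
    (hmean : slope (Λ 1) 0 ∈ I) (hgap : slope (Λ 1) 0 < slope (Λ 0) 0)
    {A : ℕ → Ω → Fin 2}
    (hA : ∀ᵐ ω ∂P, IsKLUCBPath I D (fun k i => X k i ω) (fun t => A t ω))
    {z ρ r : ℝ} (hz : z ∈ I) (hzμ : z < slope (Λ 1) 0) (hρ : conjugate (Λ 0) z ≤ ρ)
    (hρ0 : 0 ≤ ρ) (hr : ρ < r * D z (slope (Λ 1) 0)) :
    ∃ κ > 0, ∀ᶠ x : ℝ in atTop, ∀ T : ℕ, x + κ * Real.log x + 2 ≤ T →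
      ENNReal.ofReal (Real.exp (-(r * Real.log x))) ≤
        P {ω | x ≤ (plays (fun t => A t ω) 1 T : ℝ)} := by
  set μ₂ := slope (Λ 1) 0 with hμ₂
  have hD0 : 0 < D z μ₂ := lt_of_le_of_ne (hD.nonneg z hz μ₂ hmean) fun h =>
    hzμ.ne ((hD.eq_zero_iff z hz μ₂ hmean).1 h.symm)
  have hr0 : 0 < r := by
    by_contra! hr0
    nlinarith
  -- constants with `ρ / r < d' < d < D(z, μ₂)`; arm `0` gets `n = ⌈κ log x⌉` plays, `κ = 1 / d'`,
  -- so that `d n` exceeds `log x` and the cost `n ρ` stays below `r log x`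
  obtain ⟨d', hd'1, hd'2⟩ := exists_between ((div_lt_iff₀' hr0).2 hr)
  obtain ⟨d, hd1, hd2⟩ := exists_between hd'2
  have hd'0 : 0 < d' := (div_nonneg hρ0 hr0.le).trans_lt hd'1
  have hd0 : 0 < d := hd'0.trans hd1
  set κ := 1 / d' with hκ
  have hκ0 : 0 < κ := by positivity
  have hdκ : 1 < d * κ := by
    rw [hκ, mul_one_div, lt_div_iff₀ hd'0]; linarith
  have hκρ : κ * ρ < r := by
    rw [div_lt_iff₀ hr0] at hd'1
    rw [hκ, one_div_mul_eq_div, div_lt_iff₀ hd'0]; linarith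
  set η := (r - κ * ρ) / (2 * κ) with hη
  have hη0 : 0 < η := div_pos (by linarith) (by positivity)
  have hκη : κ * (ρ + η) < r := by
    have : κ * η = (r - κ * ρ) / 2 := by rw [hη]; field_simp
    linarith
  obtain ⟨e₀, he₀, hnear₀⟩ := hD.exists_nhds_lt hI hz hmean hd2
  -- the radius `e` keeps sample means of arm `0` near `z` below the level `ν = μ₂ - e / 2`
  set e := min e₀ ((μ₂ - z) / 3) with he
  have he0 : 0 < e := lt_min he₀ (by linarith)
  have hee : e ≤ (μ₂ - z) / 3 := min_le_right _ _
  have hnear : ∀ m ν, |m - z| < e → |ν - μ₂| < e → m ∈ I ∧ ν ∈ I ∧ d < D m ν :=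
    fun m ν h1 h2 => hnear₀ m ν (h1.trans_le (min_le_left _ _)) (h2.trans_le (min_le_left _ _))
  obtain ⟨N, K, hG⟩ := (hΛ 1).exists_goodRewards (hX 1) (fun m => D m μ₂)
    (δ := e / 4) (by positivity)
  have hE := (hΛ 0).eventually_lower_bound (hX 0) (hzμ.trans hgap) hρ he0 hη0
  have hκlog : Tendsto (fun x : ℝ => κ * Real.log x) atTop atTop :=
    Real.tendsto_log_atTop.const_mul_atTop hκ0
  have hnT : Tendsto (fun x : ℝ => ⌈κ * Real.log x⌉₊) atTop atTop :=
    tendsto_nat_ceil_atTop.comp hκlog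
  have hlogn : ∀ᶠ n : ℕ in atTop, |K| * N ≤ Real.log n :=
    (Real.tendsto_log_atTop.comp tendsto_natCast_atTop_atTop).eventually_ge_atTop _
  have hsmall : ∀ᶠ x : ℝ in atTop, κ * Real.log x + 2 ≤ x := by
    have h1 := (Real.isLittleO_log_id_atTop.bound (show 0 < 1 / (2 * κ) by positivity))
    filter_upwards [h1, eventually_ge_atTop 4, Real.tendsto_log_atTop.eventually_ge_atTop 0]
      with x hx hx4 hx0
    simp only [id_eq, Real.norm_eq_abs, abs_of_nonneg hx0, abs_of_nonneg (by linarith : 0 ≤ x)]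
      at hx
    rw [one_div_mul_eq_div, le_div_iff₀ (by positivity)] at hx
    linarith
  have hbig1 : ∀ᶠ x : ℝ in atTop, Real.log 2 < (d * κ - 1) * Real.log x :=
    (Real.tendsto_log_atTop.const_mul_atTop (by linarith)).eventually_gt_atTop _
  have hbig2 : ∀ᶠ x : ℝ in atTop, Real.log 2 + (ρ + η) ≤ (r - κ * (ρ + η)) * Real.log x :=
    (Real.tendsto_log_atTop.const_mul_atTop (by linarith)).eventually_ge_atTop _
  refine ⟨κ, hκ0, ?_⟩
  filter_upwards [hnT.eventually hE, hnT.eventually hlogn, hnT.eventually_ge_atTop 1, hsmall,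
    hbig1, hbig2, eventually_ge_atTop 2, hκlog.eventually_ge_atTop 0]
    with x hEx hlognx hn1 hsx hb1 hb2 hx2 hlx T hT
  set n := ⌈κ * Real.log x⌉₊ with hn
  have hn0 : (0 : ℝ) < n := by exact_mod_cast hn1
  have hnle : κ * Real.log x ≤ n := Nat.le_ceil _
  have hnlt : (n : ℝ) < κ * Real.log x + 1 := Nat.ceil_lt_add_one hlx
  set τ := ⌈x⌉₊ + n with hτ
  have hxle : x ≤ (⌈x⌉₊ : ℝ) := Nat.le_ceil _
  have hxlt : (⌈x⌉₊ : ℝ) < x + 1 := Nat.ceil_lt_add_one (by linarith)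
  have hτr : (τ : ℝ) = ⌈x⌉₊ + n := by rw [hτ]; push_cast; ring
  have hτT : τ ≤ T := by
    have : (τ : ℝ) ≤ T := by rw [hτr]; linarith
    exact_mod_cast this
  have hτ2 : 2 ≤ τ := by
    have : (2 : ℝ) ≤ τ := by rw [hτr]; linarith
    exact_mod_cast this
  have hlogτ : Real.log τ < d * n := by
    have h1 : Real.log τ ≤ Real.log (2 * x) :=
      Real.log_le_log (by exact_mod_cast (by omega : 0 < τ)) (by rw [hτr]; linarith)
    rw [Real.log_mul two_ne_zero (by linarith)] at h1
    have h2 : d * (κ * Real.log x) ≤ d * n := mul_le_mul_of_nonneg_left hnle hd0.le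
    nlinarith
  set E : Set (ℕ → ℝ) := {y | |∑ i ∈ Finset.range n, y i - n * z| < n * e} with hEdef
  have hEm : MeasurableSet E := measurableSet_lt
    ((Finset.measurable_fun_sum _ fun i _ => measurable_pi_apply i).sub_const _).abs
    measurable_const
  set G := goodRewards (fun m => D m μ₂) μ₂ (e / 4) N K with hGdef
  have hGm : MeasurableSet G := measurableSet_goodRewards (hD.measurable μ₂ hmean) _ _ _ _
  have hsub : ((fun ω i => X 0 i ω) ⁻¹' E ∩ (fun ω i => X 1 i ω) ⁻¹' G : Set Ω)
      ≤ᵐ[P] {ω | x ≤ (plays (fun t => A t ω) 1 T : ℝ)} := by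
    filter_upwards [hA] with ω hω hmem
    obtain ⟨hωE, hωG⟩ := hmem
    have hωE : |∑ i ∈ Finset.range n, X 0 i ω - n * z| < n * e := hωE
    have hscale : ∀ {j : ℕ} {s c ε : ℝ}, 0 < (j : ℝ) → |s - j * c| < j * ε → |s / j - c| < ε := by
      intro j s c ε hj h
      have e1 : s / j - c = (s - j * c) / j := by field_simp
      rw [e1, abs_div, abs_of_pos hj, div_lt_iff₀ hj]
      linarith
    have hm := hscale hn0 hωE
    have hmz := (abs_lt.1 hm).2
    -- the time `τ` is at most `T`, and `⌈x⌉` of the first `τ` plays are left for arm `1`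
    have hpath := hω.le_plays_one_add hn1 hτ2 (d := d) (ν := μ₂ - e / 2) hmean (by linarith) hD
      hlogτ ?_ ?_
    · have h1 : ⌈x⌉₊ ≤ plays (fun t => A t ω) 1 T :=
        le_trans (by omega) (plays_mono _ 1 hτT)
      exact hxle.trans (by exact_mod_cast h1)
    · intro μ hμ hνμ
      obtain ⟨hmI, -, hdν⟩ := hnear _ (μ₂ - e / 2) hm (by rw [abs_lt]; constructor <;> linarith)
      exact hdν.le.trans (hD.mono_right hmI hμ (by linarith) hνμ)
    · intro j hj
      by_cases hjN : N ≤ j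
      · left
        have hj := hscale (by exact_mod_cast hj) (hωG.1 j hjN)
        refine ⟨(hnear z _ (by simpa using he0) (hj.trans (by linarith))).2.1, ?_⟩
        have := (abs_lt.1 hj).1
        linarith
      · right
        refine le_trans ?_ hlognx
        have h1 := hωG.2 j (by omega)
        have h2 : (j : ℝ) ≤ N := by exact_mod_cast (by omega : j ≤ N)
        exact (mul_le_mul_of_nonneg_right (h1.trans (le_abs_self K)) (Nat.cast_nonneg j)).trans
          (mul_le_mul_of_nonneg_left h2 (abs_nonneg K))
  refine le_trans ?_ (measure_mono_ae hsub)
  rw [hX_indep.measure_inter_preimage_eq_mul _ _ hEm hGm]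
  refine le_trans ?_ (mul_le_mul' hEx hG)
  rw [← ENNReal.ofReal_ofNat, ← ENNReal.ofReal_inv_of_pos two_pos,
    ← ENNReal.ofReal_mul (Real.exp_pos _).le]
  refine ENNReal.ofReal_le_ofReal ?_
  have e2 : (2 : ℝ)⁻¹ = Real.exp (-Real.log 2) := by rw [Real.exp_neg, Real.exp_log two_pos]
  rw [e2, ← Real.exp_add]
  refine Real.exp_le_exp.2 ?_
  have h3 : (n : ℝ) * (ρ + η) ≤ (κ * Real.log x + 1) * (ρ + η) :=
    mul_le_mul_of_nonneg_right hnlt.le (by linarith)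
  linarith

/-- The room `γ T` between `(1 - γ) T` and `T` absorbs the logarithmic number of plays of arm `0`. -/
lemma eventually_add_log_le {γ κ : ℝ} (hγ0 : 0 < γ) (hγ1 : γ < 1) (hκ : 0 < κ) :
    ∀ᶠ T : ℕ in atTop, ∀ x : ℝ, 1 ≤ x → x ≤ (1 - γ) * T → x + κ * Real.log x + 2 ≤ T := by
  have h1 := Real.isLittleO_log_id_atTop.bound (show 0 < γ / (2 * κ) by positivity)
  filter_upwards [tendsto_natCast_atTop_atTop.eventually h1,
    tendsto_natCast_atTop_atTop.eventually_ge_atTop (4 / γ), eventually_ge_atTop 1]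
    with T hT hT4 hT1 x hx1 hx
  have hT1 : (1 : ℝ) ≤ T := by exact_mod_cast hT1
  simp only [id_eq, Real.norm_eq_abs, abs_of_nonneg (Real.log_nonneg hT1),
    abs_of_nonneg (by linarith : (0 : ℝ) ≤ T)] at hT
  have hlog : Real.log x ≤ Real.log T := Real.log_le_log (by linarith) (by nlinarith)
  have h2 : κ * Real.log x ≤ γ / 2 * T := by
    calc _ ≤ κ * (γ / (2 * κ) * T) := mul_le_mul_of_nonneg_left (hlog.trans hT) hκ.le
      _ = _ := by field_simp
  rw [div_le_iff₀ hγ0] at hT4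
  linarith

lemma GartnerEllis.conjugate_nonneg {Ω : Type*} [MeasurableSpace Ω] {P : Measure Ω}
    [IsProbabilityMeasure P] {X : ℕ → Ω → ℝ} {Λ : ℝ → EReal} (h : GartnerEllis P X Λ) (z : ℝ) :
    0 ≤ conjugate Λ z := by
  have := le_iSup (fun θ : ℝ => (((θ * z : ℝ) : EReal) - Λ θ)) 0
  simp only [zero_mul, EReal.coe_zero, h.apply_zero, sub_zero] at this
  exact this

end KLUCB

theorem theorem4 {Ω : Type*} [MeasurableSpace Ω] (P : Measure Ω) [IsProbabilityMeasure P]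
    (I : Set ℝ) (hI_open : IsOpen I) (hI_interval : I.OrdConnected)
    (D : ℝ → ℝ → ℝ) (hD : KLUCB.IsDivergence I D)
    (X : Fin 2 → ℕ → Ω → ℝ) (hX : ∀ k i, Measurable (X k i))
    (hX_indep : IndepFun (fun ω i => X 0 i ω) (fun ω i => X 1 i ω) P)
    (Λ : Fin 2 → ℝ → EReal) (hΛ : ∀ k, KLUCB.GartnerEllis P (X k) (Λ k))
    (hmean_mem : ∀ k, KLUCB.slope (Λ k) 0 ∈ I)
    (hgap : KLUCB.slope (Λ 1) 0 < KLUCB.slope (Λ 0) 0)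
    (A : ℕ → Ω → Fin 2) (hA : ∀ t, Measurable (A t))
    (hA_klucb : ∀ᵐ ω ∂P, KLUCB.IsKLUCBPath I D (fun k i => X k i ω) (fun t => A t ω))
    (γ : ℝ) (hγ0 : 0 < γ) (hγ1 : γ < 1) :
    - (⨅ z ∈ {z : ℝ | z ∈ I ∧ z < KLUCB.slope (Λ 1) 0},
        KLUCB.conjugate (Λ 0) z / ((D z (KLUCB.slope (Λ 1) 0) : ℝ) : EReal))
      ≤ liminf (fun T : ℕ =>
          ⨅ x ∈ Set.Icc (Real.log (T : ℝ) ^ (1 + γ)) ((1 - γ) * (T : ℝ)),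
            ENNReal.log (P {ω | x ≤ (KLUCB.plays (fun t => A t ω) 1 T : ℝ)})
              / ((Real.log x : ℝ) : EReal)) atTop := by
  rw [EReal.neg_le]
  refine le_iInf₂ fun z hz => ?_
  obtain ⟨hzI, hzμ⟩ := hz
  set d₀ := D z (KLUCB.slope (Λ 1) 0) with hd₀
  have hd₀pos : 0 < d₀ := lt_of_le_of_ne (hD.nonneg z hzI _ (hmean_mem 1)) fun h =>
    hzμ.ne ((hD.eq_zero_iff z hzI _ (hmean_mem 1)).1 h.symm)
  have hd₀E : (0 : EReal) < (d₀ : EReal) := by exact_mod_cast hd₀pos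
  refine EReal.le_of_forall_lt_iff_le.1 fun r hr => ?_
  rw [EReal.div_lt_iff hd₀E (EReal.coe_ne_top _), ← EReal.coe_mul] at hr
  obtain ⟨ρ, hρ1, hρ2⟩ := EReal.lt_iff_exists_real_btwn.1 hr
  have hρ0 : 0 ≤ ρ := by exact_mod_cast ((hΛ 0).conjugate_nonneg z).trans hρ1.le
  obtain ⟨κ, hκ, hev⟩ := KLUCB.eventually_le_measure_plays hI_open hD hX hX_indep hΛ
    (hmean_mem 1) hgap hA_klucb hzI hzμ hρ1.le hρ0 (by exact_mod_cast hρ2 : ρ < r * d₀)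
  obtain ⟨x₀, hx₀⟩ := eventually_atTop.1 hev
  rw [EReal.neg_le]
  refine le_liminf_of_le (by isBoundedDefault) ?_
  have hlow : Tendsto (fun T : ℕ => Real.log (T : ℝ) ^ (1 + γ)) atTop atTop :=
    (tendsto_rpow_atTop (by linarith)).comp
      (Real.tendsto_log_atTop.comp tendsto_natCast_atTop_atTop)
  filter_upwards [hlow.eventually_ge_atTop (max x₀ 2), KLUCB.eventually_add_log_le hγ0 hγ1 hκ]
    with T hT1 hT2
  refine le_iInf₂ fun x hx => ?_
  have hxx : max x₀ 2 ≤ x := hT1.trans hx.1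
  have hx2 : 2 ≤ x := (le_max_right _ _).trans hxx
  have hlogx : 0 < Real.log x := Real.log_pos (by linarith)
  have key := hx₀ x ((le_max_left _ _).trans hxx) T (hT2 x (by linarith) hx.2)
  rw [← ENNReal.log_le_log_iff, ENNReal.log_ofReal_of_pos (Real.exp_pos _), Real.log_exp] at key
  rw [EReal.le_div_iff_mul_le (by exact_mod_cast hlogx) (EReal.coe_ne_top _), ← EReal.coe_neg,
    ← EReal.coe_mul, neg_mul]
  exact key
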